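/- Let $v:\mathbb{R}\to\mathbb{R}$ be a bounded (i.e. $v\in L^\infty(\mathbb{R})$), non-negative, symmetric potential, $v(x)=v(-x)$, whose support is $[-b,b]$ for some $0<b<\infty$. Assume that for some $0<\varepsilon\le b$ the function $v$ is strictly monotonically increasing on $[-b,-\varepsilon]$ and that $\inf_{x\in[-\varepsilon,0]}v(x)>\gamma$ for some $\gamma>0$. For $L>0$ let $h_L=-\frac{d^2}{dx^2}+v$ be the Schrödinger operator on $L^2\big((-L/2,L/2)\big)$ with Neumann boundary conditions, i.e. with domain $\{\varphi\in H^2(-L/2,L/2):\varphi'(\pm L/2)=0\}$, let $\lambda_0(L)\ge 0$ be its lowest eigenvalue and put $k_0(L):=\sqrt{\lambda_0(L)}$. Then there exists a constant $\delta>0$, independent of $L$, such that for all $L$ large enough $\lambda_0(L)$ exists (the set of eigenvalues of $h_L$ has a least element, and it is non-negative) and $$\frac{\delta}{L}\ \le\ \left|\frac{\pi}{2}-k_0(L)\left(\frac{L}{2}-b\right)\right| .$$ -/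

import Mathlib

open Set Filter MeasureTheory

noncomputable section

/-- The open interval `I = (-L/2, L/2)`. -/
def boxInterval (L : ℝ) : Set ℝ := Ioo (-(L / 2)) (L / 2)

/-- `φ` belongs to the Neumann domain `{φ ∈ H²(I) : φ'(-L/2) = φ'(L/2) = 0}`, with first derivative
`φ₁` and second (weak) derivative `φ₂`. In dimension one, `φ ∈ H²(I)` means that `φ` is `C¹` on
`[-L/2, L/2]` and that its derivative is the primitive of a function in `L²(I)`. Values outside
`[-L/2, L/2]` play no role. -/
structure IsNeumannDomain (L : ℝ) (φ φ₁ φ₂ : ℝ → ℂ) : Prop where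
  memLp_two : MemLp φ₂ 2 (volume.restrict (boxInterval L))
  primitive_fst : ∀ x ∈ Icc (-(L / 2)) (L / 2), φ₁ x = φ₁ (-(L / 2)) + ∫ t in (-(L / 2))..x, φ₂ t
  primitive : ∀ x ∈ Icc (-(L / 2)) (L / 2), φ x = φ (-(L / 2)) + ∫ t in (-(L / 2))..x, φ₁ t
  neumann_left : φ₁ (-(L / 2)) = 0
  neumann_right : φ₁ (L / 2) = 0

/-- `E` is an eigenvalue of `h_L = -d²/dx² + v` in `L²(I)` with Neumann boundary conditions: there
is a function in the domain, nonzero as an element of `L²(I)`, with `-φ'' + v φ = E φ` a.e. -/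
def IsNeumannEigenvalue (v : ℝ → ℝ) (L E : ℝ) : Prop :=
  ∃ φ φ₁ φ₂ : ℝ → ℂ, IsNeumannDomain L φ φ₁ φ₂ ∧
    (¬ φ =ᵐ[volume.restrict (boxInterval L)] 0) ∧
    ∀ᵐ x ∂(volume.restrict (boxInterval L)), -φ₂ x + (v x : ℂ) * φ x = (E : ℂ) * φ x

/-- The lowest eigenvalue `λ₀(L)` of `h_L`. -/
def groundEnergy (v : ℝ → ℝ) (L : ℝ) : ℝ := sInf {E : ℝ | IsNeumannEigenvalue v L E}

/-- `k₀(L) = √(λ₀(L))`. -/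
def groundMomentum (v : ℝ → ℝ) (L : ℝ) : ℝ := Real.sqrt (groundEnergy v L)

end

/-! Let `φ` be the even solution of `φ'' = (v - E) φ` with `φ 0 = 1`, `φ' 0 = 0`. It depends
continuously on `E`, and at `E = 0` it satisfies `φ ≥ 1` and `φ' b ≥ 0` (`exists_solution_family`).
Beyond `b` the potential vanishes, so with `E = k²` and `l = L/2 - b` the Neumann condition at `L/2`
reads `k sin(kl) φ(b) = cos(kl) φ'(b)`. The intermediate value theorem gives a root `k` with `0 ≤ kl
< π/2`, for which `φ` is positive on the whole box (`exists_positive_neumann_solution`).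

A positive Neumann solution is a ground state, by Picone's identity (`neumann_solution_ae_eq_zero`),
so `k = k₀(L)`. As `E` stays in a fixed small interval, `φ'(b)/φ(b)` is at most a constant `C`
independent of `L`. Hence `k cot(π/2 - kl) ≤ C`: the gap `π/2 - kl` is either of order one or at
least of order `k/C`, and in the latter case `k` is at least of order `1/L` (`pi_half_sub_ge`). -/

/-! ### Even solutions of the initial value problem, from a Volterra equation -/

/-- Each integration gains a factor `1/μ` against the weight `exp (μ |x|)`; a large `μ` thus makes
the double integral a contraction on the whole line. -/
theorem abs_integral_le_of_abs_le_exp {g : ℝ → ℝ} {c μ : ℝ} (hμ : 0 < μ) (hc : 0 ≤ c)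
    (hg : ∀ᵐ t, |g t| ≤ c * Real.exp (μ * |t|)) (x : ℝ) :
    |∫ t in (0 : ℝ)..x, g t| ≤ c / μ * Real.exp (μ * |x|) := by
  have key : ∀ f : ℝ → ℝ, (∀ᵐ t, |f t| ≤ c * Real.exp (μ * |t|)) → ∀ y, 0 ≤ y →
      |∫ t in (0 : ℝ)..y, f t| ≤ c / μ * Real.exp (μ * |y|) := by
    intro f hf y hy
    have hcont : Continuous fun t : ℝ => c * Real.exp (μ * t) := by fun_prop
    have h1 : ‖∫ t in (0 : ℝ)..y, f t‖ ≤ ∫ t in (0 : ℝ)..y, c * Real.exp (μ * t) := by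
      refine intervalIntegral.norm_integral_le_of_norm_le hy ?_ (hcont.intervalIntegrable _ _)
      filter_upwards [hf] with t ht h0
      rwa [abs_of_pos h0.1] at ht
    have h2 : ∫ t in (0 : ℝ)..y, c * Real.exp (μ * t) =
        c / μ * Real.exp (μ * y) - c / μ * Real.exp (μ * 0) := by
      refine intervalIntegral.integral_eq_sub_of_hasDerivAt
        (f := fun t => c / μ * Real.exp (μ * t)) (fun t _ => ?_) (hcont.intervalIntegrable _ _)
      have := (((hasDerivAt_id t).const_mul μ).exp).const_mul (c / μ)
      refine this.congr_deriv ?_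
      rw [id]
      field_simp
    rw [h2, Real.norm_eq_abs] at h1
    rw [abs_of_nonneg hy]
    have : 0 ≤ c / μ * Real.exp (μ * 0) := by positivity
    linarith
  rcases le_total 0 x with hx | hx
  · exact key g hg x hx
  · have h := key (fun t => g (-t))
      ((Measure.measurePreserving_neg (volume : Measure ℝ)).quasiMeasurePreserving.ae
        (p := fun t => |g t| ≤ c * Real.exp (μ * |t|)) hg |>.mono
        fun t ht => by simpa using ht) (-x) (by linarith)
    rw [intervalIntegral.integral_comp_neg, neg_neg, neg_zero, intervalIntegral.integral_symm,
      abs_neg, abs_neg] at h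
    exact h

/-- The Volterra operator `f ↦ ∫₀ˣ ∫₀ˢ w f`, acting on functions divided by `exp (μ |x|)`. -/
theorem exists_weighted_volterra {w : ℝ → ℝ} {M μ : ℝ} (hμ : 0 < μ) (hM : 0 ≤ M)
    (hw : ∀ a b : ℝ, IntervalIntegrable w volume a b) (hwM : ∀ᵐ t, |w t| ≤ M) :
    ∃ A : (BoundedContinuousFunction ℝ ℝ) →L[ℝ] (BoundedContinuousFunction ℝ ℝ),
      ‖A‖ ≤ M / μ ^ 2 ∧ ∀ f x, A f x = Real.exp (-(μ * |x|)) *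
        ∫ s in (0 : ℝ)..x, ∫ t in (0 : ℝ)..s, w t * (Real.exp (μ * |t|) * f t) := by
  have hint : ∀ (f : BoundedContinuousFunction ℝ ℝ) (a b : ℝ),
      IntervalIntegrable (fun t => w t * (Real.exp (μ * |t|) * f t)) volume a b := fun f a b =>
    (hw a b).mul_continuousOn (by fun_prop)
  have hcont1 : ∀ f : BoundedContinuousFunction ℝ ℝ,
      Continuous fun s : ℝ => ∫ t in (0 : ℝ)..s, w t * (Real.exp (μ * |t|) * f t) := fun f =>
    intervalIntegral.continuous_primitive (hint f) 0
  have hcont2 : ∀ f : BoundedContinuousFunction ℝ ℝ,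
      Continuous fun x : ℝ => ∫ s in (0 : ℝ)..x, ∫ t in (0 : ℝ)..s,
        w t * (Real.exp (μ * |t|) * f t) := fun f =>
    intervalIntegral.continuous_primitive (fun a b => (hcont1 f).intervalIntegrable a b) 0
  have hbd : ∀ (f : BoundedContinuousFunction ℝ ℝ) (x : ℝ), ‖Real.exp (-(μ * |x|)) *
      ∫ s in (0 : ℝ)..x, ∫ t in (0 : ℝ)..s, w t * (Real.exp (μ * |t|) * f t)‖ ≤
        M / μ ^ 2 * ‖f‖ := by
    intro f x
    have h1 := abs_integral_le_of_abs_le_exp (c := M * ‖f‖) hμ (by positivity)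
      (g := fun t => w t * (Real.exp (μ * |t|) * f t)) (by
        filter_upwards [hwM] with t ht
        rw [abs_mul, abs_mul, Real.abs_exp]
        have h3 : |f t| ≤ ‖f‖ := f.norm_coe_le_norm t
        calc |w t| * (Real.exp (μ * |t|) * |f t|) ≤ M * (Real.exp (μ * |t|) * ‖f‖) := by gcongr
          _ = _ := by ring)
    have h2 := abs_integral_le_of_abs_le_exp (c := M * ‖f‖ / μ) hμ (by positivity)
      (Eventually.of_forall h1) x
    rw [norm_mul, Real.norm_eq_abs, Real.norm_eq_abs, Real.abs_exp]
    calc _ ≤ Real.exp (-(μ * |x|)) * (M * ‖f‖ / μ / μ * Real.exp (μ * |x|)) := by gcongr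
      _ = M * ‖f‖ / μ / μ * (Real.exp (-(μ * |x|)) * Real.exp (μ * |x|)) := by ring
      _ = _ := by
        rw [← Real.exp_add, neg_add_cancel, Real.exp_zero]
        field_simp
  let A₀ : (BoundedContinuousFunction ℝ ℝ) →ₗ[ℝ] (BoundedContinuousFunction ℝ ℝ) :=
    { toFun := fun f => BoundedContinuousFunction.ofNormedAddCommGroup
        (fun x => Real.exp (-(μ * |x|)) *
          ∫ s in (0 : ℝ)..x, ∫ t in (0 : ℝ)..s, w t * (Real.exp (μ * |t|) * f t))
        ((by fun_prop : Continuous fun x : ℝ => Real.exp (-(μ * |x|))).mul (hcont2 f)) _ (hbd f)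
      map_add' := by
        intro f g
        ext x
        simp only [BoundedContinuousFunction.coe_ofNormedAddCommGroup,
          BoundedContinuousFunction.add_apply]
        rw [← mul_add, ← intervalIntegral.integral_add ((hcont1 f).intervalIntegrable _ _)
          ((hcont1 g).intervalIntegrable _ _)]
        congr 1
        refine intervalIntegral.integral_congr fun s _ => ?_
        rw [← intervalIntegral.integral_add (hint f _ _) (hint g _ _)]
        refine intervalIntegral.integral_congr fun t _ => ?_
        ring
      map_smul' := by
        intro c f
        ext x
        simp only [BoundedContinuousFunction.coe_ofNormedAddCommGroup,
          BoundedContinuousFunction.smul_apply, smul_eq_mul, RingHom.id_apply]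
        rw [mul_left_comm]
        congr 1
        rw [← intervalIntegral.integral_const_mul]
        refine intervalIntegral.integral_congr fun s _ => ?_
        rw [← intervalIntegral.integral_const_mul]
        refine intervalIntegral.integral_congr fun t _ => ?_
        ring }
  have hA₀ : ∀ f, ‖A₀ f‖ ≤ M / μ ^ 2 * ‖f‖ := fun f =>
    (BoundedContinuousFunction.norm_le (by positivity)).2 (hbd f)
  exact ⟨A₀.mkContinuous _ hA₀, A₀.mkContinuous_norm_le (by positivity) hA₀, fun f x => rfl⟩

theorem integral_integral_comp_neg (h : ℝ → ℝ) (x : ℝ) :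
    (∫ s in (0 : ℝ)..x, ∫ t in (0 : ℝ)..s, h (-t)) =
      ∫ s in (0 : ℝ)..-x, ∫ t in (0 : ℝ)..s, h t := by
  have h1 : ∀ s : ℝ, (∫ t in (0 : ℝ)..s, h (-t)) = -∫ t in (0 : ℝ)..-s, h t := fun s => by
    rw [intervalIntegral.integral_comp_neg, neg_zero, intervalIntegral.integral_symm]
  simp_rw [h1]
  rw [intervalIntegral.integral_neg,
    intervalIntegral.integral_comp_neg (fun s => ∫ t in (0 : ℝ)..s, h t), neg_zero,
    intervalIntegral.integral_symm, neg_neg]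

/-- The family is `(1 - (A - E B))⁻¹ e`, continuous in `E` because inversion is continuous at units.
The Neumann series at `E = 0` is recorded to transfer positivity from `A`. -/
theorem exists_resolvent_family {X : Type*} [NormedAddCommGroup X] [NormedSpace ℝ X]
    [CompleteSpace X] (A B : X →L[ℝ] X) (hAB : ‖A‖ + ‖B‖ < 1) (e : X) :
    ∃ g : ℝ → X, ContinuousOn g (Icc 0 1) ∧
      (∀ E ∈ Icc (0 : ℝ) 1, g E = e + (A (g E) - E • B (g E))) ∧
      (∀ E ∈ Icc (0 : ℝ) 1, ∀ f, f = e + (A f - E • B f) → f = g E) ∧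
      HasSum (fun n : ℕ => (A ^ n) e) (g 0) := by
  have hK : ∀ E ∈ Icc (0 : ℝ) 1, ‖A - E • B‖ < 1 := by
    intro E hE
    calc ‖A - E • B‖ ≤ ‖A‖ + ‖E • B‖ := norm_sub_le _ _
      _ ≤ ‖A‖ + ‖B‖ := by
        rw [norm_smul, Real.norm_eq_abs, abs_of_nonneg hE.1]
        have : E * ‖B‖ ≤ 1 * ‖B‖ := mul_le_mul_of_nonneg_right hE.2 (norm_nonneg _)
        linarith
      _ < 1 := hAB
  refine ⟨fun E => Ring.inverse (1 - (A - E • B)) e, ?_, ?_, ?_, ?_⟩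
  · intro E hE
    refine ContinuousAt.continuousWithinAt ?_
    have hu := NormedRing.inverse_continuousAt (isUnit_one_sub_of_norm_lt_one (hK E hE)).unit
    have h1 : ContinuousAt (fun E : ℝ => (1 : X →L[ℝ] X) - (A - E • B)) E := by fun_prop
    have h2 : ContinuousAt (fun E : ℝ => Ring.inverse ((1 : X →L[ℝ] X) - (A - E • B))) E :=
      ContinuousAt.comp (g := Ring.inverse) hu h1
    exact h2.clm_apply continuousAt_const
  · intro E hE
    have h1 : (1 - (A - E • B)) * Ring.inverse (1 - (A - E • B)) = 1 :=
      Ring.mul_inverse_cancel _ (isUnit_one_sub_of_norm_lt_one (hK E hE))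
    have h2 := congrArg (fun T : X →L[ℝ] X => T e) h1
    change Ring.inverse (1 - (A - E • B)) e - (A (Ring.inverse (1 - (A - E • B)) e) -
      E • B (Ring.inverse (1 - (A - E • B)) e)) = e at h2
    rw [sub_eq_iff_eq_add] at h2
    exact h2
  · intro E hE f hf
    have h1 : Ring.inverse (1 - (A - E • B)) * (1 - (A - E • B)) = 1 :=
      Ring.inverse_mul_cancel _ (isUnit_one_sub_of_norm_lt_one (hK E hE))
    have h2 := congrArg (fun T : X →L[ℝ] X => T f) h1
    change Ring.inverse (1 - (A - E • B)) (f - (A f - E • B f)) = f at h2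
    rw [sub_eq_of_eq_add hf] at h2
    exact h2.symm
  · have hA1 : ‖A‖ < 1 := by linarith [norm_nonneg B]
    have h1 : HasSum (fun n : ℕ => A ^ n) (Ring.inverse (1 - A)) := by
      rw [NormedRing.inverse_one_sub A hA1]
      exact (summable_geometric_of_norm_lt_one hA1).hasSum
    have h2 := h1.mapL (ContinuousLinearMap.apply ℝ X e)
    simpa using h2

/-- Solutions of `φ'' = (v - E) φ`, `φ 0 = 1`, `φ' 0 = 0`, depending continuously on `E`. -/
theorem exists_solution_family {v : ℝ → ℝ} {M : ℝ} (hM : 0 ≤ M)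
    (hv : ∀ a b : ℝ, IntervalIntegrable v volume a b) (hvM : ∀ᵐ t, |v t| ≤ M)
    (hv0 : ∀ t, 0 ≤ v t) (hsymm : ∀ t, v t = v (-t)) :
    ∃ (μ : ℝ) (g : ℝ → BoundedContinuousFunction ℝ ℝ), 0 < μ ∧ ContinuousOn g (Icc 0 1) ∧
      (∀ E ∈ Icc (0 : ℝ) 1, ∀ x, Real.exp (μ * |x|) * g E x =
        1 + ∫ s in (0 : ℝ)..x, ∫ t in (0 : ℝ)..s, (v t - E) * (Real.exp (μ * |t|) * g E t)) ∧
      (∀ E ∈ Icc (0 : ℝ) 1, ∀ x, g E (-x) = g E x) ∧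
      ∀ x, 1 ≤ Real.exp (μ * |x|) * g 0 x := by
  -- With this weight `(M + 1) / μ²` equals `1 / (4 (M + 1)) < 1`.
  set μ : ℝ := 2 * (M + 1) with hμdef
  have hμ : 0 < μ := by positivity
  have hsmall : M / μ ^ 2 + 1 / μ ^ 2 < 1 := by
    rw [← add_div, div_lt_one (by positivity), hμdef]
    nlinarith
  obtain ⟨A, hA, hAf⟩ := exists_weighted_volterra hμ hM hv hvM
  obtain ⟨B, hB, hBf⟩ := exists_weighted_volterra (w := fun _ => (1 : ℝ)) (M := 1) hμ zero_le_one
    (fun a b => intervalIntegrable_const) (by simp)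
  -- The constant function `1` divided by the weight.
  let e : BoundedContinuousFunction ℝ ℝ := BoundedContinuousFunction.ofNormedAddCommGroup
    (fun x => Real.exp (-(μ * |x|))) (by fun_prop) 1 (by
      intro x
      rw [Real.norm_eq_abs, Real.abs_exp, Real.exp_le_one_iff]
      have : 0 ≤ μ * |x| := by positivity
      linarith)
  obtain ⟨g, hgc, hfix, huniq, hsum⟩ := exists_resolvent_family A B
    (lt_of_le_of_lt (add_le_add hA hB) hsmall) e
  refine ⟨μ, g, hμ, hgc, ?_, ?_, ?_⟩
  · intro E hE x
    have h1 := congrArg (fun f : BoundedContinuousFunction ℝ ℝ => f x) (hfix E hE)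
    simp only [BoundedContinuousFunction.add_apply, BoundedContinuousFunction.sub_apply,
      BoundedContinuousFunction.smul_apply, hAf, hBf, smul_eq_mul] at h1
    have h2 : e x = Real.exp (-(μ * |x|)) := rfl
    have hi1 : ∀ a b, IntervalIntegrable (fun t => v t * (Real.exp (μ * |t|) * g E t))
        volume a b := fun a b => (hv a b).mul_continuousOn (by fun_prop)
    have hi2 : ∀ a b, IntervalIntegrable (fun t => 1 * (Real.exp (μ * |t|) * g E t))
        volume a b := fun a b => Continuous.intervalIntegrable (by fun_prop) _ _
    have h3 : (∫ s in (0 : ℝ)..x, ∫ t in (0 : ℝ)..s, (v t - E) * (Real.exp (μ * |t|) * g E t)) =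
        (∫ s in (0 : ℝ)..x, ∫ t in (0 : ℝ)..s, v t * (Real.exp (μ * |t|) * g E t)) -
        E * ∫ s in (0 : ℝ)..x, ∫ t in (0 : ℝ)..s, 1 * (Real.exp (μ * |t|) * g E t) := by
      rw [← intervalIntegral.integral_const_mul, ← intervalIntegral.integral_sub
        ((intervalIntegral.continuous_primitive hi1 0).intervalIntegrable _ _)
        (((intervalIntegral.continuous_primitive hi2 0).const_mul E).intervalIntegrable _ _)]
      refine intervalIntegral.integral_congr fun s _ => ?_
      rw [← intervalIntegral.integral_const_mul, ← intervalIntegral.integral_sub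
        (hi1 _ _) ((hi2 _ _).const_mul E)]
      refine intervalIntegral.integral_congr fun t _ => ?_
      ring
    rw [h3, h1, h2]
    have h4 : Real.exp (μ * |x|) * Real.exp (-(μ * |x|)) = 1 := by
      rw [← Real.exp_add, add_neg_cancel, Real.exp_zero]
    linear_combination (1 + (∫ s in (0 : ℝ)..x, ∫ t in (0 : ℝ)..s, v t *
      (Real.exp (μ * |t|) * g E t)) -
        E * ∫ s in (0 : ℝ)..x, ∫ t in (0 : ℝ)..s, 1 * (Real.exp (μ * |t|) * g E t)) * h4
  · intro E hE x
    -- Since `v` is even, the reflected solution solves the same fixed-point equation; uniqueness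
    -- gives evenness.
    let f : BoundedContinuousFunction ℝ ℝ := (g E).compContinuous ⟨fun y : ℝ => -y, continuous_neg⟩
    have hf : ∀ y, f y = g E (-y) := fun y => rfl
    have hAn : ∀ y, A f y = A (g E) (-y) := by
      intro y
      rw [hAf, hAf, abs_neg, ← integral_integral_comp_neg]
      simp only [abs_neg, ← hsymm, hf]
    have hBn : ∀ y, B f y = B (g E) (-y) := by
      intro y
      rw [hBf, hBf, abs_neg, ← integral_integral_comp_neg]
      simp only [abs_neg, hf]
    have hfe : f = g E := by
      refine huniq E hE f ?_
      ext y
      have h1 := congrArg (fun f : BoundedContinuousFunction ℝ ℝ => f (-y)) (hfix E hE)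
      have h2 : e (-y) = e y := by
        change Real.exp (-(μ * |(-y)|)) = Real.exp (-(μ * |y|))
        rw [abs_neg]
      simp only [BoundedContinuousFunction.add_apply, BoundedContinuousFunction.sub_apply,
        BoundedContinuousFunction.smul_apply] at h1 ⊢
      rw [hf, hAn, hBn, h1, h2]
    rw [← hf, hfe]
  -- As `v ≥ 0`, all terms of the Neumann series are nonnegative, so the sum dominates its zeroth
  -- term `e`.
  · have hpos : ∀ f : BoundedContinuousFunction ℝ ℝ, (∀ x, 0 ≤ f x) → ∀ x, 0 ≤ A f x := by
      intro f hf x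
      rw [hAf]
      refine mul_nonneg (Real.exp_pos _).le ?_
      have hn : ∀ t, 0 ≤ v t * (Real.exp (μ * |t|) * f t) := fun t =>
        mul_nonneg (hv0 t) (mul_nonneg (Real.exp_pos _).le (hf t))
      rcases le_total 0 x with hx | hx
      · exact intervalIntegral.integral_nonneg hx fun s hs =>
          intervalIntegral.integral_nonneg hs.1 fun t _ => hn t
      · rw [intervalIntegral.integral_symm, ← intervalIntegral.integral_neg]
        refine intervalIntegral.integral_nonneg hx fun s hs => ?_
        rw [intervalIntegral.integral_symm, neg_neg]
        exact intervalIntegral.integral_nonneg hs.2 fun t _ => hn t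
    have hpow : ∀ n : ℕ, ∀ x, 0 ≤ (A ^ n) e x := by
      intro n
      induction n with
      | zero => exact fun x => (Real.exp_pos _).le
      | succ n ih =>
        intro x
        rw [pow_succ']
        exact hpos _ ih x
    intro x
    have hsx : HasSum (fun n : ℕ => (A ^ n) e x) (g 0 x) :=
      hsum.mapL (BoundedContinuousFunction.evalCLM ℝ x)
    have h0 : e x ≤ g 0 x := by
      have := hsx.summable.sum_le_tsum (Finset.range 1) (fun n _ => hpow n x)
      rw [hsx.tsum_eq] at this
      simpa using this
    calc (1 : ℝ) = Real.exp (μ * |x|) * Real.exp (-(μ * |x|)) := by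
          rw [← Real.exp_add, add_neg_cancel, Real.exp_zero]
      _ ≤ _ := by gcongr; exact h0

/-! ### Comparison of Neumann solutions at different energies -/

theorem AbsolutelyContinuousOnInterval.of_eqOn {f g : ℝ → ℝ} {a b : ℝ}
    (hf : AbsolutelyContinuousOnInterval f a b) (h : EqOn f g (uIcc a b)) :
    AbsolutelyContinuousOnInterval g a b := by
  rw [absolutelyContinuousOnInterval_iff] at hf ⊢
  intro ε hε
  obtain ⟨δ, hδ, H⟩ := hf ε hε
  refine ⟨δ, hδ, fun I hI hI2 => ?_⟩
  have h1 := H I hI hI2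
  rwa [Finset.sum_congr rfl fun i hi => by
    rw [h (hI.1 i hi).1, h (hI.1 i hi).2]] at h1

theorem absolutelyContinuous_of_primitive {f f' : ℝ → ℝ} {a b : ℝ} (hab : a ≤ b)
    (hf' : IntervalIntegrable f' volume a b)
    (h : ∀ x ∈ Icc a b, f x = f a + ∫ t in a..x, f' t) :
    AbsolutelyContinuousOnInterval f a b ∧
      ∀ᵐ x, x ∈ Ioo a b → HasDerivAt f (f' x) x := by
  have hI : uIcc a b = Icc a b := uIcc_of_le hab
  constructor
  · have h1 := hf'.absolutelyContinuousOnInterval_intervalIntegral (c := a) (by simp)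
    have h2 : AbsolutelyContinuousOnInterval (fun _ : ℝ => f a) a b :=
      contDiffOn_const.absolutelyContinuousOnInterval
    refine (h2.add h1).of_eqOn fun x hx => ?_
    rw [hI] at hx
    exact (h x hx).symm
  · filter_upwards [hf'.ae_hasDerivAt_integral] with x hx hxI
    have h1 := (hx (hI ▸ Ioo_subset_Icc_self hxI) a (by simp)).const_add (f a)
    refine h1.congr_of_eventuallyEq ?_
    filter_upwards [Ioo_mem_nhds hxI.1 hxI.2] with y hy
    exact h y (Ioo_subset_Icc_self hy)

/-- A positive Neumann solution at energy `E` excludes Neumann solutions at lower energies. -/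
theorem neumann_solution_ae_eq_zero {R E E' : ℝ} {v φ φ₁ ψ ψ₁ ψ₂ : ℝ → ℝ} (hR : 0 ≤ R)
    (hφ : ∀ x, HasDerivAt φ (φ₁ x) x)
    (hφ₁c : Continuous φ₁)
    (hφ₁ : AbsolutelyContinuousOnInterval φ₁ (-R) R)
    (hφ₁' : ∀ᵐ x, x ∈ Ioo (-R) R → HasDerivAt φ₁ ((v x - E) * φ x) x)
    (hpos : ∀ x ∈ Icc (-R) R, 0 < φ x)
    (hφl : φ₁ (-R) = 0) (hφr : φ₁ R = 0)
    (hψ : AbsolutelyContinuousOnInterval ψ (-R) R)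
    (hψ' : ∀ᵐ x, x ∈ Ioo (-R) R → HasDerivAt ψ (ψ₁ x) x)
    (hψ₁ : AbsolutelyContinuousOnInterval ψ₁ (-R) R)
    (hψ₁' : ∀ᵐ x, x ∈ Ioo (-R) R → HasDerivAt ψ₁ (ψ₂ x) x)
    (hψ₂ : ∀ᵐ x, x ∈ Ioo (-R) R → ψ₂ x = (v x - E') * ψ x)
    (hψl : ψ₁ (-R) = 0) (hψr : ψ₁ R = 0) (hE : E' < E) :
    ∀ᵐ x, x ∈ Ioo (-R) R → ψ x = 0 := by
  have hRR : -R ≤ R := by linarith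
  have hI : uIcc (-R) R = Icc (-R) R := uIcc_of_le hRR
  have hφC : ContDiff ℝ 1 φ := by
    rw [contDiff_one_iff_deriv]
    refine ⟨fun x => (hφ x).differentiableAt, ?_⟩
    rwa [show deriv φ = φ₁ from funext fun x => (hφ x).deriv]
  have hinv : AbsolutelyContinuousOnInterval (fun x => (φ x)⁻¹) (-R) R :=
    (hφC.contDiffOn.inv fun x hx => (hpos x (hI ▸ hx)).ne').absolutelyContinuousOnInterval
  -- Picone's identity: `F` vanishes at both endpoints, while `F'` is a square plus `(E - E') ψ²`.
  -- So `F'`, being nonnegative with zero integral, vanishes almost everywhere.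
  let F : ℝ → ℝ := fun x => ψ x * ψ₁ x - (φ₁ x * (φ x)⁻¹) * (ψ x * ψ x)
  have hF : AbsolutelyContinuousOnInterval F (-R) R :=
    (hψ.fun_mul hψ₁).fun_sub ((hφ₁.fun_mul hinv).fun_mul (hψ.fun_mul hψ))
  have hF' : ∀ᵐ x, x ∈ Ioo (-R) R → deriv F x =
      (ψ₁ x - φ₁ x * (φ x)⁻¹ * ψ x) ^ 2 + (E - E') * ψ x ^ 2 := by
    filter_upwards [hφ₁', hψ', hψ₁', hψ₂] with x h1 h2 h3 h4 hx
    have hp := (hpos x (Ioo_subset_Icc_self hx)).ne'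
    have h5 := ((h2 hx).mul (h3 hx)).sub
      (((h1 hx).mul ((hφ x).inv hp)).mul ((h2 hx).mul (h2 hx)))
    have h6 := h5.deriv
    change deriv F x = _ at h6
    rw [h6, h4 hx]
    simp only [Pi.mul_apply, Pi.inv_apply]
    field_simp
    ring
  have hint := hF.integral_deriv_eq_sub
  have h0 : F R - F (-R) = 0 := by simp [F, hφl, hφr, hψl, hψr]
  rw [h0, intervalIntegral.integral_of_le hRR, integral_Ioc_eq_integral_Ioo] at hint
  have hii : IntegrableOn (deriv F) (Ioo (-R) R) :=
    ((intervalIntegrable_iff_integrableOn_Ioc_of_le hRR).1 hF.intervalIntegrable_deriv).mono_set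
      Ioo_subset_Ioc_self
  have hnn : 0 ≤ᵐ[volume.restrict (Ioo (-R) R)] deriv F := by
    rw [EventuallyLE, ae_restrict_iff' measurableSet_Ioo]
    filter_upwards [hF'] with x hx hxI
    rw [hx hxI]
    have : 0 ≤ E - E' := by linarith
    simp only [Pi.zero_apply]
    positivity
  have hz := (integral_eq_zero_iff_of_nonneg_ae hnn hii).1 hint
  rw [EventuallyEq, ae_restrict_iff' measurableSet_Ioo] at hz
  filter_upwards [hz, hF'] with x h1 h2 hx
  have h3 := h1 hx
  rw [h2 hx, Pi.zero_apply] at h3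
  have h4 : 0 < E - E' := by linarith
  have h5 : (E - E') * ψ x ^ 2 = 0 := by
    nlinarith [sq_nonneg (ψ₁ x - φ₁ x * (φ x)⁻¹ * ψ x), mul_nonneg h4.le (sq_nonneg (ψ x))]
  simpa [h4.ne'] using h5

/-! ### Matching at `b` and the positive Neumann solution -/

/-- Beyond the support of the potential a solution with vanishing Wronskian against
`cos (k (R - x))` satisfies the Neumann condition at `R` and stays positive. -/
theorem neumann_and_pos_of_wronskian_eq_zero {φ φ₁ : ℝ → ℝ} {b R k : ℝ} (hbR : b ≤ R)
    (hk : 0 ≤ k) (hkR : k * (R - b) < Real.pi / 2) (hφ : ∀ x, HasDerivAt φ (φ₁ x) x)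
    (hφ₁ : ∀ x, b ≤ x → HasDerivWithinAt φ₁ (-(k ^ 2) * φ x) (Ici x) x)
    (hφ₁c : Continuous φ₁)
    (hW : k * Real.sin (k * (R - b)) * φ b - Real.cos (k * (R - b)) * φ₁ b = 0)
    (hφb : 0 < φ b) :
    φ₁ R = 0 ∧ ∀ x ∈ Icc b R, 0 < φ x := by
  have hφc : Continuous φ := continuous_iff_continuousAt.2 fun x => (hφ x).continuousAt
  have hlin : ∀ x, HasDerivAt (fun y : ℝ => k * (R - y)) (-k) x := fun x => by
    simpa using ((hasDerivAt_id x).const_sub R).const_mul k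
  have hcos : ∀ x ∈ Icc b R, 0 < Real.cos (k * (R - x)) := by
    intro x hx
    have h1 : 0 ≤ k * (R - x) := mul_nonneg hk (by linarith [hx.2])
    have h2 : k * (R - x) ≤ k * (R - b) := mul_le_mul_of_nonneg_left (by linarith [hx.1]) hk
    exact Real.cos_pos_of_mem_Ioo ⟨by linarith [Real.pi_pos], by linarith⟩
  have hWc : ∀ x ∈ Icc b R,
      k * Real.sin (k * (R - x)) * φ x - Real.cos (k * (R - x)) * φ₁ x = 0 := by
    intro x hx
    rw [← hW]
    refine constant_of_has_deriv_right_zero (f := fun x => k * Real.sin (k * (R - x)) * φ x -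
      Real.cos (k * (R - x)) * φ₁ x) (Continuous.continuousOn (by fun_prop)) (fun y hy => ?_) x hx
    have h1 := (((hlin y).sin.const_mul k).mul (hφ y)).hasDerivWithinAt.sub
      ((hlin y).cos.hasDerivWithinAt.mul (hφ₁ y hy.1))
    refine HasDerivWithinAt.congr_deriv h1 ?_
    ring
  constructor
  · have h := hWc R (right_mem_Icc.2 hbR)
    simpa using h
  · intro x hx
    -- The numerator of the derivative of this quotient is the vanishing Wronskian up to sign.
    have hq := constant_of_has_deriv_right_zero (f := fun x => φ x / Real.cos (k * (R - x)))
      (a := b) (b := R) (hφc.continuousOn.div (Continuous.continuousOn (by fun_prop))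
        fun y hy => (hcos y hy).ne') (fun y hy => by
        have hy' := Ico_subset_Icc_self hy
        have h1 := ((hφ y).div (hlin y).cos (hcos y hy').ne').hasDerivWithinAt (s := Ici y)
        refine HasDerivWithinAt.congr_deriv h1 ?_
        rw [div_eq_zero_iff]
        left
        linear_combination -(hWc y hy')) x hx
    have h2 : 0 < φ x / Real.cos (k * (R - x)) := by
      rw [hq]
      exact div_pos hφb (hcos b (left_mem_Icc.2 hbR))
    exact (div_pos_iff_of_pos_right (hcos x hx)).1 h2

/-- The essential point is that `C` precedes `L`: it bounds `φ₁ b / φ b` uniformly over small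
energies, and for large `L` every candidate `k²` is small. -/
theorem exists_positive_neumann_solution {v : ℝ → ℝ} {M b : ℝ} (hM : 0 ≤ M) (hb : 0 < b)
    (hv : ∀ a b : ℝ, IntervalIntegrable v volume a b) (hvM : ∀ᵐ t, |v t| ≤ M)
    (hv0 : ∀ t, 0 ≤ v t) (hsymm : ∀ t, v t = v (-t)) (hvb : ∀ t, b < t → v t = 0) :
    ∃ C : ℝ, 0 < C ∧ ∀ᶠ L : ℝ in atTop, ∃ (k : ℝ) (φ φ₁ : ℝ → ℝ), 0 ≤ k ∧
      k * (L / 2 - b) < Real.pi / 2 ∧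
      k * Real.sin (k * (L / 2 - b)) ≤ C * Real.cos (k * (L / 2 - b)) ∧
      Continuous φ ∧ Continuous φ₁ ∧
      (∀ x, φ x = 1 + ∫ t in (0 : ℝ)..x, φ₁ t) ∧
      (∀ x, φ₁ x = ∫ t in (0 : ℝ)..x, (v t - k ^ 2) * φ t) ∧
      (∀ x, φ (-x) = φ x) ∧ (∀ x ∈ Icc (-(L / 2)) (L / 2), 0 < φ x) ∧ φ₁ (L / 2) = 0 := by
  obtain ⟨μ, g, hμ, hgc, hfix, heven, hone⟩ := exists_solution_family hM hv hvM hv0 hsymm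
  let φ : ℝ → ℝ → ℝ := fun E x => Real.exp (μ * |x|) * g E x
  let φ₁ : ℝ → ℝ → ℝ := fun E x => ∫ t in (0 : ℝ)..x, (v t - E) * φ E t
  have hφc : ∀ E, Continuous (φ E) := fun E => by fun_prop
  have hint : ∀ E a b, IntervalIntegrable (fun t => (v t - E) * φ E t) volume a b := fun E a b =>
    ((hv a b).sub intervalIntegrable_const).mul_continuousOn (hφc E).continuousOn
  have hφ₁c : ∀ E, Continuous (φ₁ E) := fun E => intervalIntegral.continuous_primitive (hint E) 0
  have hφeq : ∀ E ∈ Icc (0 : ℝ) 1, ∀ x, φ E x = 1 + ∫ s in (0 : ℝ)..x, φ₁ E s := hfix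
  have hφE : ∀ x, ContinuousOn (fun E => φ E x) (Icc 0 1) := fun x =>
    continuousOn_const.mul ((BoundedContinuousFunction.evalCLM ℝ x).continuous.comp_continuousOn hgc)
  have hφ₁E : ContinuousOn (fun E => φ₁ E b) (Icc 0 1) := by
    intro E hE
    have hev : ∀ᶠ E' in nhdsWithin E (Icc 0 1), ‖g E'‖ < ‖g E‖ + 1 :=
      (hgc E hE).norm.eventually (Iio_mem_nhds (by simp))
    refine intervalIntegral.continuousWithinAt_of_dominated_interval
      (bound := fun t => (M + 1) * (Real.exp (μ * |t|) * (‖g E‖ + 1)))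
      (Eventually.of_forall fun E' => (intervalIntegrable_iff.1 (hint E' 0 b)).aestronglyMeasurable) ?_
      (Continuous.intervalIntegrable (by fun_prop) _ _)
      (Eventually.of_forall fun t _ =>
        (continuousWithinAt_const.sub continuousWithinAt_id).mul (hφE t E hE))
    filter_upwards [hev, self_mem_nhdsWithin] with E' h1 h2
    filter_upwards [hvM] with t ht _
    have h3 : |g E' t| ≤ ‖g E‖ + 1 := ((g E').norm_coe_le_norm t).trans h1.le
    have h4 : |v t - E'| ≤ M + 1 := by
      have := abs_sub (v t) E'
      rw [abs_of_nonneg h2.1] at this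
      linarith [h2.2]
    rw [norm_mul, norm_mul, Real.norm_eq_abs, Real.norm_eq_abs, Real.norm_eq_abs, Real.abs_exp]
    gcongr
  have h01 : (0 : ℝ) ∈ Icc (0 : ℝ) 1 := by simp
  have hφ₁0 : 0 ≤ φ₁ 0 b := intervalIntegral.integral_nonneg hb.le fun t _ =>
    mul_nonneg (by linarith [hv0 t]) (by linarith [hone t])
  -- On `[0, b]` the weight is at most `exp (μ b)`, so this tolerance lowers the bound `φ 0 x ≥ 1`
  -- by at most `1/2`.
  have hev : ∀ᶠ E in nhdsWithin (0 : ℝ) (Icc 0 1),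
      dist (g E) (g 0) < Real.exp (-(μ * b)) / 2 ∧ φ₁ E b < φ₁ 0 b + 1 :=
    ((hgc 0 h01).eventually (Metric.ball_mem_nhds _ (by positivity))).and
      ((hφ₁E 0 h01).eventually (Iio_mem_nhds (by simp)))
  obtain ⟨η₀, hη₀, hη⟩ := Metric.eventually_nhds_iff.1 (eventually_nhdsWithin_iff.1 hev)
  obtain ⟨η, hηpos, hη1, hηη₀⟩ : ∃ η : ℝ, 0 < η ∧ η ≤ 1 ∧ η < η₀ :=
    ⟨min 1 (η₀ / 2), by positivity, min_le_left _ _, (min_le_right _ _).trans_lt (by linarith)⟩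
  have hsmall : ∀ E ∈ Icc 0 η, (∀ x ∈ Icc 0 b, 1 / 2 ≤ φ E x) ∧ φ₁ E b ≤ φ₁ 0 b + 1 := by
    intro E hE
    obtain ⟨h1, h2⟩ := hη (y := E)
      (by rw [dist_zero_right, Real.norm_eq_abs, abs_of_nonneg hE.1]; linarith [hE.2])
      ⟨hE.1, hE.2.trans hη1⟩
    refine ⟨fun x hx => ?_, h2.le⟩
    have h3 := (BoundedContinuousFunction.dist_coe_le_dist (f := g E) (g := g 0) x).trans h1.le
    rw [Real.dist_eq] at h3
    have h4 : g 0 x - Real.exp (-(μ * b)) / 2 ≤ g E x := by linarith [(abs_le.1 h3).1]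
    have h5 : Real.exp (μ * |x|) * Real.exp (-(μ * b)) ≤ 1 := by
      rw [← Real.exp_add, Real.exp_le_one_iff, abs_of_nonneg hx.1]
      nlinarith [hx.2]
    have h6 := mul_le_mul_of_nonneg_left h4 (Real.exp_pos (μ * |x|)).le
    have h7 := hone x
    change 1 / 2 ≤ Real.exp (μ * |x|) * g E x
    nlinarith
  -- Here `φ₁ E b ≤ φ₁ 0 b + 1` and `φ E b ≥ 1/2` for all `E` in `[0, η]`.
  refine ⟨2 * (φ₁ 0 b + 1), by positivity, ?_⟩
  filter_upwards [eventually_ge_atTop (2 * b + Real.pi / η)] with L hL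
  set l : ℝ := L / 2 - b with hl
  have hlη : Real.pi / 2 ≤ l * η := by
    have : Real.pi / η / 2 ≤ l := by rw [hl]; linarith
    calc Real.pi / 2 = Real.pi / η / 2 * η := by field_simp
      _ ≤ l * η := by gcongr
  have hlpos : 0 < l := by
    by_contra h
    nlinarith [Real.pi_pos]
  set k₁ : ℝ := Real.pi / 2 / l with hk₁
  have hk₁pos : 0 < k₁ := by positivity
  have hk₁η : k₁ ≤ η := by rw [hk₁, div_le_iff₀ hlpos]; linarith
  have hk₁l : k₁ * l = Real.pi / 2 := by rw [hk₁]; field_simp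
  have hsq : ∀ k ∈ Icc 0 k₁, k ^ 2 ∈ Icc 0 η := fun k hk =>
    ⟨sq_nonneg k, by nlinarith [hk.1, hk.2]⟩
  have hη01 : Icc 0 η ⊆ Icc (0 : ℝ) 1 := Icc_subset_Icc_right hη1
  have hGc : ContinuousOn (fun k : ℝ => k * Real.sin (k * l) * φ (k ^ 2) b -
      Real.cos (k * l) * φ₁ (k ^ 2) b) (Icc 0 k₁) := by
    have h1 : ContinuousOn (fun k : ℝ => k ^ 2) (Icc 0 k₁) := by fun_prop
    have hm : MapsTo (fun k : ℝ => k ^ 2) (Icc 0 k₁) (Icc 0 1) := fun k hk => hη01 (hsq k hk)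
    have h2 : ContinuousOn (fun k : ℝ => φ (k ^ 2) b) (Icc 0 k₁) := (hφE b).comp h1 hm
    have h3 : ContinuousOn (fun k : ℝ => φ₁ (k ^ 2) b) (Icc 0 k₁) := hφ₁E.comp h1 hm
    exact ((Continuous.continuousOn (by fun_prop)).mul h2).sub
      ((Continuous.continuousOn (by fun_prop)).mul h3)
  have hG1 : 0 < k₁ * φ (k₁ ^ 2) b := mul_pos hk₁pos
    (by linarith [(hsmall _ (hsq k₁ ⟨hk₁pos.le, le_rfl⟩)).1 b ⟨hb.le, le_rfl⟩])
  -- The matching function is `-φ₁ 0 b ≤ 0` at `k = 0`. At `k₁ = π / (2 l)` the cosine vanishes and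
  -- it is positive.
  obtain ⟨k, hk, hGk⟩ := intermediate_value_Icc hk₁pos.le hGc
    (show (0 : ℝ) ∈ _ by
      constructor
      · simpa using hφ₁0
      · simp only [hk₁l, Real.sin_pi_div_two, Real.cos_pi_div_two]
        linarith)
  simp only at hGk
  have hkne : k ≠ k₁ := by
    rintro rfl
    rw [hk₁l, Real.sin_pi_div_two, Real.cos_pi_div_two] at hGk
    linarith
  have hklt : k * l < Real.pi / 2 := by
    rw [← hk₁l]
    exact mul_lt_mul_of_pos_right (lt_of_le_of_ne hk.2 hkne) hlpos
  obtain ⟨hlow, hup⟩ := hsmall _ (hsq k hk)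
  have hkE := hη01 (hsq k hk)
  have hφb := hlow b ⟨hb.le, le_rfl⟩
  have hderiv : ∀ x, HasDerivAt (φ (k ^ 2)) (φ₁ (k ^ 2) x) x := by
    intro x
    have h1 := ((hφ₁c (k ^ 2)).integral_hasStrictDerivAt 0 x).hasDerivAt.const_add 1
    rwa [← show φ (k ^ 2) = _ from funext (hφeq _ hkE)] at h1
  -- Only right derivatives are available: `v` may jump at `b`, so `φ₁` need not be differentiable
  -- there.
  have hderiv₁ : ∀ x, b ≤ x → HasDerivWithinAt (φ₁ (k ^ 2)) (-(k ^ 2) * φ (k ^ 2) x) (Ici x) x := by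
    intro x hx
    have hc : Continuous fun t => -(k ^ 2) * φ (k ^ 2) t := continuous_const.mul (hφc _)
    have h1 := ((hc.integral_hasStrictDerivAt b x).hasDerivAt.const_add
      (φ₁ (k ^ 2) b)).hasDerivWithinAt (s := Ici x)
    have h2 : ∀ y ∈ Ici x, φ₁ (k ^ 2) y = φ₁ (k ^ 2) b + ∫ t in b..y, -(k ^ 2) * φ (k ^ 2) t := by
      intro y hy
      have hby : b ≤ y := hx.trans hy
      have h3 : ∫ t in b..y, -(k ^ 2) * φ (k ^ 2) t = ∫ t in b..y, (v t - k ^ 2) * φ (k ^ 2) t :=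
        intervalIntegral.integral_congr_ae (Eventually.of_forall fun t ht => by
          rw [uIoc_of_le hby] at ht
          rw [hvb t ht.1, zero_sub])
      rw [h3, ← intervalIntegral.integral_interval_sub_left (hint _ 0 y) (hint _ 0 b)]
      change _ = φ₁ (k ^ 2) b + (φ₁ (k ^ 2) y - φ₁ (k ^ 2) b)
      ring
    exact h1.congr h2 (h2 x self_mem_Ici)
  obtain ⟨hN, hP⟩ := neumann_and_pos_of_wronskian_eq_zero (R := L / 2) (by rw [hl] at hlpos; linarith)
    hk.1 hklt hderiv hderiv₁ (hφ₁c _) hGk (by linarith)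
  have hP' : ∀ x, 0 ≤ x → x ≤ L / 2 → 0 < φ (k ^ 2) x := by
    intro x h0 h1
    rcases le_total x b with h2 | h2
    · linarith [hlow x ⟨h0, h2⟩]
    · exact hP x ⟨h2, h1⟩
  have hE : ∀ x, φ (k ^ 2) (-x) = φ (k ^ 2) x := by
    intro x
    change Real.exp (μ * |(-x)|) * g (k ^ 2) (-x) = Real.exp (μ * |x|) * g (k ^ 2) x
    rw [abs_neg, heven _ hkE]
  refine ⟨k, φ (k ^ 2), φ₁ (k ^ 2), hk.1, hklt, ?_, hφc _, hφ₁c _, hφeq _ hkE, fun x => rfl,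
    hE, ?_, hN⟩
  · have hc : 0 < Real.cos (k * l) := Real.cos_pos_of_mem_Ioo
      ⟨by have := mul_nonneg hk.1 hlpos.le; linarith [Real.pi_pos], hklt⟩
    have h1 : φ₁ (k ^ 2) b ≤ 2 * (φ₁ 0 b + 1) * φ (k ^ 2) b := by nlinarith
    have h2 : k * Real.sin (k * l) * φ (k ^ 2) b ≤
        2 * (φ₁ 0 b + 1) * Real.cos (k * l) * φ (k ^ 2) b := by
      calc _ = Real.cos (k * l) * φ₁ (k ^ 2) b := by linarith
        _ ≤ Real.cos (k * l) * (2 * (φ₁ 0 b + 1) * φ (k ^ 2) b) := by gcongr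
        _ = _ := by ring
    exact le_of_mul_le_mul_right h2 (by linarith)
  · intro x hx
    rcases le_total 0 x with h0 | h0
    · exact hP' x h0 hx.2
    · rw [← hE]
      exact hP' (-x) (by linarith) (by linarith [hx.1])

/-! ### The quantitative gap, the lowest eigenvalue and the conclusion -/

theorem pi_half_sub_ge {C k l L : ℝ} (hC : 0 < C) (hL : 1 ≤ L) (hl : 0 < l)
    (hlL : l ≤ L / 2) (hkl : k * l < Real.pi / 2)
    (h : k * Real.sin (k * l) ≤ C * Real.cos (k * l)) :
    min (1 / 2) (1 / (2 * C)) / L ≤ Real.pi / 2 - k * l := by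
  obtain ⟨y, hy⟩ : ∃ y, y = Real.pi / 2 - k * l := ⟨_, rfl⟩
  have hL0 : 0 < L := by linarith
  have hkl' : k * l = Real.pi / 2 - y := by linarith
  rw [hkl', Real.sin_pi_div_two_sub, Real.cos_pi_div_two_sub] at h
  rw [← hy]
  have hy0 : 0 < y := by linarith
  have hpi := Real.pi_gt_three
  rw [div_le_iff₀ hL0]
  -- For `y ≥ 1/2` the bound follows from `L ≥ 1`. Otherwise `cos y ≥ 1/2` gives `k/2 ≤ C y`, and `k
  -- l = π/2 - y ≥ 1` with `l ≤ L/2` gives `k L ≥ 1`.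
  rcases le_total (1 / 2) y with h1 | h1
  · calc min (1 / 2) (1 / (2 * C)) ≤ 1 / 2 := min_le_left _ _
      _ ≤ y * L := by nlinarith
  · refine (min_le_right _ _).trans ?_
    rw [div_le_iff₀ (by positivity)]
    have hc : 1 / 2 ≤ Real.cos y := by nlinarith [Real.one_sub_sq_div_two_le_cos (x := y)]
    have hs : Real.sin y ≤ y := Real.sin_le hy0.le
    have hk0 : 0 < k := by
      by_contra hk
      nlinarith
    have hkL : 1 ≤ k * L := by nlinarith
    have h2 : k * (1 / 2) ≤ C * y := by
      calc k * (1 / 2) ≤ k * Real.cos y := by gcongr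
        _ ≤ C * Real.sin y := h
        _ ≤ C * y := by gcongr
    nlinarith

/-- A positive even solution of the Neumann problem realizes the lowest eigenvalue. -/
theorem isLeast_neumannEigenvalue {v φ φ₁ : ℝ → ℝ} {M L E : ℝ} (hL : 0 < L)
    (hv : ∀ a b : ℝ, IntervalIntegrable v volume a b) (hvM : ∀ᵐ t, |v t| ≤ M)
    (hsymm : ∀ t, v t = v (-t)) (hφc : Continuous φ) (hφ₁c : Continuous φ₁)
    (hφ : ∀ x, φ x = 1 + ∫ t in (0 : ℝ)..x, φ₁ t)
    (hφ₁ : ∀ x, φ₁ x = ∫ t in (0 : ℝ)..x, (v t - E) * φ t)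
    (heven : ∀ x, φ (-x) = φ x) (hpos : ∀ x ∈ Icc (-(L / 2)) (L / 2), 0 < φ x)
    (hr : φ₁ (L / 2) = 0) :
    IsLeast {E : ℝ | IsNeumannEigenvalue v L E} E := by
  have hint : ∀ a b, IntervalIntegrable (fun t => (v t - E) * φ t) volume a b := fun a b =>
    ((hv a b).sub intervalIntegrable_const).mul_continuousOn hφc.continuousOn
  have hLL : -(L / 2) ≤ L / 2 := by linarith
  have hl : φ₁ (-(L / 2)) = 0 := by
    have h1 := intervalIntegral.integral_comp_neg (a := 0) (b := L / 2)
      (fun t => (v t - E) * φ t)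
    simp only [← hsymm, heven, neg_zero] at h1
    rw [← hφ₁, hr] at h1
    rw [hφ₁, intervalIntegral.integral_symm, ← h1, neg_zero]
  have hφ₁p : ∀ x, φ₁ x = φ₁ (-(L / 2)) + ∫ t in (-(L / 2))..x, (v t - E) * φ t := by
    intro x
    rw [← intervalIntegral.integral_interval_sub_left (hint 0 x) (hint 0 (-(L / 2))),
      ← hφ₁, ← hφ₁]
    ring
  have hφp : ∀ x, φ x = φ (-(L / 2)) + ∫ t in (-(L / 2))..x, φ₁ t := by
    intro x
    rw [← intervalIntegral.integral_interval_sub_left (hφ₁c.intervalIntegrable 0 x)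
      (hφ₁c.intervalIntegrable 0 (-(L / 2))), hφ x, hφ (-(L / 2))]
    ring
  constructor
  · refine ⟨fun x => (φ x : ℂ), fun x => (φ₁ x : ℂ), fun x => (((v x - E) * φ x : ℝ) : ℂ),
      ⟨?_, ?_, ?_, ?_, ?_⟩, ?_, ?_⟩
    · obtain ⟨B, hB⟩ := (isCompact_Icc (a := -(L / 2)) (b := L / 2)).exists_bound_of_continuousOn
        hφc.continuousOn
      have hm : AEStronglyMeasurable (fun t => (v t - E) * φ t)
          (volume.restrict (boxInterval L)) :=
        (((intervalIntegrable_iff_integrableOn_Ioc_of_le hLL).1 (hint _ _)).mono_set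
          Ioo_subset_Ioc_self).aestronglyMeasurable
      have : IsFiniteMeasure (volume.restrict (boxInterval L)) := by
        unfold boxInterval
        infer_instance
      refine MemLp.of_bound (Complex.continuous_ofReal.comp_aestronglyMeasurable hm)
        ((M + |E|) * B) ?_
      filter_upwards [ae_restrict_of_ae hvM, ae_restrict_mem measurableSet_Ioo] with x h1 h2
      have h3 := hB x (Ioo_subset_Icc_self h2)
      have h4 : |v x - E| ≤ M + |E| := (abs_sub _ _).trans (by linarith)
      rw [Complex.norm_real, norm_mul]
      exact mul_le_mul h4 h3 (norm_nonneg _) ((abs_nonneg _).trans h4)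
    · intro x _
      rw [intervalIntegral.integral_ofReal, ← Complex.ofReal_add, ← hφ₁p]
    · intro x _
      rw [intervalIntegral.integral_ofReal, ← Complex.ofReal_add, ← hφp]
    · simp [hl]
    · simp [hr]
    · intro h0
      have hne : (ae (volume.restrict (boxInterval L))).NeBot := by
        rw [ae_neBot, Ne, Measure.restrict_eq_zero, boxInterval, Real.volume_Ioo]
        simp only [ENNReal.ofReal_eq_zero, not_le]
        linarith
      obtain ⟨x, h1, h2⟩ := (h0.and (ae_restrict_mem measurableSet_Ioo)).exists
      have h3 := hpos x (Ioo_subset_Icc_self h2)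
      simp only [Pi.zero_apply, Complex.ofReal_eq_zero] at h1
      linarith
    · refine Eventually.of_forall fun x => ?_
      push_cast
      ring
  · rintro E' ⟨ψ, ψ₁, ψ₂, hD, hne, heq⟩
    by_contra hlt
    rw [not_le] at hlt
    have hR : 0 ≤ L / 2 := by linarith
    have hderiv : ∀ x, HasDerivAt φ (φ₁ x) x := by
      intro x
      have h1 := (hφ₁c.integral_hasStrictDerivAt 0 x).hasDerivAt.const_add 1
      rwa [← show φ = _ from funext hφ] at h1
    obtain ⟨hφ₁ac, hφ₁d⟩ := absolutelyContinuous_of_primitive hLL (hint _ _) fun x _ => hφ₁p x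
    have hψ₂i : IntervalIntegrable ψ₂ volume (-(L / 2)) (L / 2) := by
      have : IsFiniteMeasure (volume.restrict (boxInterval L)) := by
        unfold boxInterval
        infer_instance
      rw [intervalIntegrable_iff_integrableOn_Ioo_of_le hLL]
      exact hD.memLp_two.integrable one_le_two
    have hψ₁i : IntervalIntegrable ψ₁ volume (-(L / 2)) (L / 2) := by
      have h1 : ContinuousOn (fun x => ψ₁ (-(L / 2)) + ∫ t in (-(L / 2))..x, ψ₂ t)
          (uIcc (-(L / 2)) (L / 2)) :=
        continuousOn_const.add (intervalIntegral.continuousOn_primitive_interval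
          ((intervalIntegrable_iff').1 hψ₂i))
      refine (h1.congr fun x hx => ?_).intervalIntegrable
      exact hD.primitive_fst x (uIcc_of_le hLL ▸ hx)
    rw [boxInterval, ae_restrict_iff' measurableSet_Ioo] at heq
    -- The real comparison is applied to the real and imaginary parts of `ψ` separately, both being
    -- solutions since `v` and `E'` are real.
    have key : ∀ T : ℂ →L[ℝ] ℝ, (∀ (r : ℝ) (z : ℂ), T (r * z) = r * T z) →
        ∀ᵐ x, x ∈ Ioo (-(L / 2)) (L / 2) → T (ψ x) = 0 := by
      intro T hT
      have hsub : ∀ x ∈ Icc (-(L / 2)) (L / 2), uIcc (-(L / 2)) x ⊆ uIcc (-(L / 2)) (L / 2) :=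
        fun x hx => uIcc_subset_uIcc left_mem_uIcc (uIcc_of_le hLL ▸ hx)
      have i2 : IntervalIntegrable (fun x => T (ψ₂ x)) volume (-(L / 2)) (L / 2) :=
        ⟨T.integrable_comp hψ₂i.1, T.integrable_comp hψ₂i.2⟩
      have i1 : IntervalIntegrable (fun x => T (ψ₁ x)) volume (-(L / 2)) (L / 2) :=
        ⟨T.integrable_comp hψ₁i.1, T.integrable_comp hψ₁i.2⟩
      obtain ⟨a1, d1⟩ := absolutelyContinuous_of_primitive (f := fun x => T (ψ₁ x)) hLL i2
        fun x hx => by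
          rw [T.intervalIntegral_comp_comm (hψ₂i.mono_set (hsub x hx)), ← map_add,
            ← hD.primitive_fst x hx]
      obtain ⟨a0, d0⟩ := absolutelyContinuous_of_primitive (f := fun x => T (ψ x)) hLL i1
        fun x hx => by
          rw [T.intervalIntegral_comp_comm (hψ₁i.mono_set (hsub x hx)), ← map_add,
            ← hD.primitive x hx]
      refine neumann_solution_ae_eq_zero hR hderiv hφ₁c hφ₁ac hφ₁d hpos hl hr a0 d0 a1 d1 ?_
        (by simp [hD.neumann_left]) (by simp [hD.neumann_right]) hlt
      filter_upwards [heq] with x hx hxI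
      have h1 : ψ₂ x = ((v x - E' : ℝ) : ℂ) * ψ x := by
        push_cast
        linear_combination -(hx hxI)
      rw [h1, hT]
    refine hne ?_
    rw [EventuallyEq, boxInterval, ae_restrict_iff' measurableSet_Ioo]
    filter_upwards [key Complex.reCLM (fun r z => by simp), key Complex.imCLM (fun r z => by simp)]
      with x h1 h2 hx
    exact Complex.ext (h1 hx) (h2 hx)

theorem mainTheorem3 (v : ℝ → ℝ) (b ε γ : ℝ)
    (hb : 0 < b)
    (v_bdd : MemLp v ⊤ volume)
    (v_symm : ∀ x, v x = v (-x))
    (v_nonneg : ∀ x, 0 ≤ v x)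
    (v_supp : tsupport v = Icc (-b) b)
    (hε : 0 < ε) (hεb : ε ≤ b)
    (v_mono : StrictMonoOn v (Icc (-b) (-ε)))
    (hγ : 0 < γ) (v_inf : γ < sInf (v '' Icc (-ε) 0)) :
    ∃ δ : ℝ, 0 < δ ∧ ∀ᶠ L : ℝ in atTop,
      IsLeast {E : ℝ | IsNeumannEigenvalue v L E} (groundEnergy v L) ∧
      0 ≤ groundEnergy v L ∧
      δ / L ≤ |Real.pi / 2 - groundMomentum v L * (L / 2 - b)| := by
  have hv : ∀ a b : ℝ, IntervalIntegrable v volume a b := fun a b =>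
    ((v_bdd.locallyIntegrable le_top).integrableOn_isCompact isCompact_uIcc).intervalIntegrable
  obtain ⟨M, hM, hvM⟩ : ∃ M : ℝ, 0 ≤ M ∧ ∀ᵐ t, |v t| ≤ M := by
    have h1 := v_bdd.eLpNorm_ne_top
    rw [eLpNorm_exponent_top] at h1
    refine ⟨(eLpNormEssSup v volume).toReal, ENNReal.toReal_nonneg, ?_⟩
    filter_upwards [enorm_ae_le_eLpNormEssSup v volume] with t ht
    simpa using ENNReal.toReal_mono h1 ht
  have hvb : ∀ t, b < t → v t = 0 := fun t ht => image_eq_zero_of_notMem_tsupport (by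
    rw [v_supp]
    exact fun h => not_le.2 ht h.2)
  obtain ⟨C, hC, hev⟩ := exists_positive_neumann_solution hM hb hv hvM v_nonneg v_symm hvb
  refine ⟨min (1 / 2) (1 / (2 * C)), by positivity, ?_⟩
  filter_upwards [hev, eventually_ge_atTop 1, eventually_gt_atTop (2 * b)] with L hex hL1 hLb
  obtain ⟨k, φ, φ₁, hk, hkl, hkC, hφc, hφ₁c, hφ, hφ₁, heven, hpos, hr⟩ := hex
  have hleast := isLeast_neumannEigenvalue (by linarith) hv hvM v_symm hφc hφ₁c hφ hφ₁ heven hpos hr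
  have hE : groundEnergy v L = k ^ 2 := hleast.csInf_eq
  have hmom : groundMomentum v L = k := by rw [groundMomentum, hE, Real.sqrt_sq hk]
  rw [hmom, hE]
  exact ⟨hleast, sq_nonneg k,
    (pi_half_sub_ge hC hL1 (by linarith) (by linarith) hkl hkC).trans (le_abs_self _)⟩
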